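/- Consider Rabin's randomized mutual exclusion algorithm for $n\ge 1$ processes $1,\dots,n$. The shared variable is $V=(S,B,R)$ with $S\in\{0,1\}$, $B\in\{0,\dots,b\}$, $R\in\{0,\dots,99\}$, where $b=\lceil\log_2 n\rceil+4$; initially $S=B=0$ and $R$ is uniformly random. Process $i$ has local variables $B_i$ (initially $1$) and $R_i$ (initially $\bot$), and runs cyclically through the regions $Try$, $Crit$, $Exit$, $Rem$, starting in $Rem$. When a process in $Rem$ or $Try$ is given a step, it atomically executes the following: if $V=(0,B_i,R_i)$, it sets $V\leftarrow(1,0,r)$ with $r$ uniform in $\{0,\dots,99\}$ and enters $Crit$; otherwise, if $V.R\ne R_i$ or $V.B<B_i$, it draws a new lottery number $B_i$, sets $V.B\leftarrow\max(V.B,B_i)$ and $R_i\leftarrow V.R$; and it is then in $Try$. A step of a process in $Crit$ sets $V.S\leftarrow 0$, $R_i\leftarrow\bot$, $B_i\leftarrow 0$ and leads to $Exit$, and its next step leads to $Rem$. Lottery numbers have the law $\mathbf P[\beta=l]=2^{-l}$ for $1\le l<b$ and $\mathbf P[\beta=b]=2^{-(b-1)}$; all random draws are independent. A run is the sequence of triplets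 (process, old region, new region) of the steps of an execution. An adversary $\mathcal A$ is a map from finite runs to processes, which chooses the process that takes the next step; it is fair if, in every execution, every process in $Try$, $Crit$ or $Exit$ is eventually given a step. It is compatible with a run if each process in the run is the one that $\mathcal A$ chooses after the preceding triplets. $\mathbf P_{\mathcal A}$ is the resulting probability on executions. A round ends with each transition $Try\to Crit$, and the next round starts after it; a $k$-round run consists of exactly $k$ complete rounds. $\pi_k$ is the run up to the end of round $k$; $\mathcal P(k)$ is the set of processes that take a step of the trying code during round $k$ (with $\mathcal P(k)=\emptyset$ if there are fewer than $k$ rounds); $W_i(k)$ is the event that process $i$ enters $Crit$ at the end of round $k$. **Theorem 3.2.** There is a constant $c$ with $0<c<1$ such that for every $n\ge 1$ there are a fair adversary $\mathcal A$, a round $k\ge 1$ and a $(k-1)$-round run $\rho$ compatible with $\mathcal A$ with $\mathbf P_{\mathcal A}[\pi_{k-1}=\rho,\ 1\in\mathcal P(k)]\ne 0$ and $$\mathbf P_{\mathcal A}[W_1(k)\mid \pi_{k-1}=\rho,\ 1\in\mathcal P(k)]\le e^{-32}+c^n .$$ Moreover, the algorithm does not have the weak, run-knowing no-lockout property: there is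 no constant $c>0$ such that for every $n\geq 1$, every fair adversary $\mathcal A$, every $k\ge1$, every $(k-1)$-round run $\rho$ compatible with $\mathcal A$ and every process $i$ with $\mathbf P_{\mathcal A}[\pi_{k-1}=\rho,\ i\in\mathcal P(k)]\ne0$, $$\mathbf P_{\mathcal A}[W_i(k)\mid \pi_{k-1}=\rho,\ i\in\mathcal P(k)]\ge c/n .$$ -/

import Mathlib

open MeasureTheory ProbabilityTheory
open scoped ENNReal

noncomputable section

namespace Rabin

/-- The four regions of the program, run cyclically in the order `Try`, `Crit`, `Exit`, `Rem`. -/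
inductive Region
  | Try | Crit | Exit | Rem
  deriving DecidableEq

/-- The largest lottery number, `⌈log₂ n⌉ + 4`, for `n` processes. -/
def maxLottery (n : ℕ) : ℕ := Nat.clog 2 n + 4

/-- The lottery numbers that can be drawn: `1, …, maxLottery n`. -/
abbrev Lottery (n : ℕ) : Type := Finset.Icc 1 (maxLottery n)

/-- The geometric distribution of parameter `1/2`, truncated at `b`: the number `l < b` has
weight `2⁻ˡ`, and `b` carries the remaining mass `2^{-(b-1)}`. -/
def lotteryWeight (b l : ℕ) : ℝ≥0∞ := if l < b then 2⁻¹ ^ l else 2⁻¹ ^ (b - 1)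

theorem sum_half_pow (m : ℕ) :
    ∑ l ∈ Finset.Icc 1 m, (2⁻¹ : ℝ≥0∞) ^ l + 2⁻¹ ^ m = 1 := by
  induction m with
  | zero => simp
  | succ m ih =>
    rw [Finset.sum_Icc_succ_top (by omega), add_assoc]
    have h : (2⁻¹ : ℝ≥0∞) ^ (m + 1) + 2⁻¹ ^ (m + 1) = 2⁻¹ ^ m := by
      rw [pow_succ, ← mul_add, ENNReal.inv_two_add_inv_two, mul_one]
    rw [h, ih]

theorem sum_lotteryWeight (n : ℕ) :
    ∑ l : Lottery n, lotteryWeight (maxLottery n) (l : ℕ) = 1 := by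
  rw [Finset.sum_coe_sort (Finset.Icc 1 (maxLottery n)) (lotteryWeight (maxLottery n))]
  unfold maxLottery
  rw [Finset.sum_Icc_succ_top (by omega), ← sum_half_pow (Nat.clog 2 n + 3)]
  congr 1
  · refine Finset.sum_congr rfl fun l hl => ?_
    rw [Finset.mem_Icc] at hl
    simp [lotteryWeight, show l < Nat.clog 2 n + 4 by omega]
  · simp [lotteryWeight]

/-- The law of a lottery draw. -/
def lotteryPMF (n : ℕ) : PMF (Lottery n) :=
  PMF.ofFintype (fun l => lotteryWeight (maxLottery n) (l : ℕ)) (sum_lotteryWeight n)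

/-- The randomness available to one step: a lottery number and a round number. -/
abbrev Coin (n : ℕ) : Type := Lottery n × Fin 100

/-- A random source: coin `0` gives the initial round number, and coin `t + 1` is the one that
the step number `t` (counted from `0`) uses if the code asks for it. -/
abbrev Source (n : ℕ) : Type := ℕ → Coin n

/-- Independent coins, each made of a truncated geometric lottery number and an independent
round number, uniform among 100 values. -/
def sourceMeasure (n : ℕ) : Measure (Source n) :=
  Measure.infinitePi fun _ : ℕ =>
    (lotteryPMF n).toMeasure.prod (PMF.uniformOfFintype (Fin 100)).toMeasure

/-- A global state: the shared variable `V = (S, B, R)`, and for each process `i` its local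
variables `B_i`, `R_i` (`none` stands for `⊥`) and its current region. -/
structure Config (n : ℕ) where
  S : Fin 2
  B : ℕ
  R : Fin 100
  locB : Fin n → ℕ
  locR : Fin n → Option (Fin 100)
  region : Fin n → Region

/-- The initial state, with initial round number `r`. -/
def Config.init (n : ℕ) (r : Fin 100) : Config n where
  S := 0
  B := 0
  R := r
  locB := fun _ => 1
  locR := fun _ => none
  region := fun _ => Region.Rem

/-- A step of process `i` in its trying code: the code between a `lock` and the next `unlock`.
If `V = (0, B_i, R_i)`, the loop is left, `V` becomes `(1, 0, random)`, and `i` enters `Crit`.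
Otherwise the body of the loop is run once, and `i` is in `Try` afterwards. -/
def Config.tryStep {n : ℕ} (C : Config n) (i : Fin n) (ξ : Coin n) : Config n :=
  if C.S = 0 ∧ C.B = C.locB i ∧ some C.R = C.locR i then
    { C with
      S := 1
      B := 0
      R := ξ.2
      region := Function.update C.region i Region.Crit }
  else if some C.R ≠ C.locR i ∨ C.B < C.locB i then
    { C with
      B := max C.B (ξ.1 : ℕ)
      locB := Function.update C.locB i (ξ.1 : ℕ)
      locR := Function.update C.locR i (some C.R)
      region := Function.update C.region i Region.Try }
  else
    { C with region := Function.update C.region i Region.Try }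

/-- One step of process `i`. A process in `Rem` that is given a step locks the shared variable and
runs the trying code. A process in `Crit` that is given a step leaves the critical region and
runs `V.S ← 0; R_i ← ⊥; B_i ← 0`; its next step takes it from `Exit` to `Rem`. -/
def Config.step {n : ℕ} (C : Config n) (i : Fin n) (ξ : Coin n) : Config n :=
  match C.region i with
  | Region.Rem => C.tryStep i ξ
  | Region.Try => C.tryStep i ξ
  | Region.Crit =>
    { C with
      S := 0
      locB := Function.update C.locB i 0
      locR := Function.update C.locR i none
      region := Function.update C.region i Region.Exit }
  | Region.Exit => { C with region := Function.update C.region i Region.Rem }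

/-- A triplet `(p, old, new)`: process `p` takes a step with the region change `old → new`. -/
structure Triplet (n : ℕ) where
  p : Fin n
  old : Region
  new : Region

/-- A finite run, in chronological order. -/
abbrev Run (n : ℕ) : Type := List (Triplet n)

/-- An adversary chooses the next process from the current finite run, and from nothing else. -/
abbrev Adversary (n : ℕ) : Type := Run n → Fin n

/-- The state and the run after `t` steps of the execution that the adversary `A` and the
source `ω` determine. -/
def exec {n : ℕ} (A : Adversary n) (ω : Source n) : ℕ → Config n × Run n
  | 0 => (Config.init n (ω 0).2, [])
  | t + 1 =>
    let C := (exec A ω t).1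
    let ρ := (exec A ω t).2
    let C' := C.step (A ρ) (ω (t + 1))
    (C', ρ ++ [⟨A ρ, C.region (A ρ), C'.region (A ρ)⟩])

/-- The state after `t` steps. -/
def configAt {n : ℕ} (A : Adversary n) (ω : Source n) (t : ℕ) : Config n := (exec A ω t).1

/-- The run `π_t` of the first `t` steps. -/
def runAt {n : ℕ} (A : Adversary n) (ω : Source n) (t : ℕ) : Run n := (exec A ω t).2

/-- The triplet of the step number `t` (counted from `0`), i.e. of the step that leads from
`configAt A ω t` to `configAt A ω (t + 1)`. -/
def tripletAt {n : ℕ} (A : Adversary n) (ω : Source n) (t : ℕ) : Triplet n :=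
  ⟨A (runAt A ω t), (configAt A ω t).region (A (runAt A ω t)),
    (configAt A ω (t + 1)).region (A (runAt A ω t))⟩

/-- In every execution, every process in `Try`, `Crit` or `Exit` is eventually given a step. -/
def Fair {n : ℕ} (A : Adversary n) : Prop :=
  ∀ (ω : Source n) (t : ℕ) (i : Fin n), (configAt A ω t).region i ≠ Region.Rem →
    ∃ t', t ≤ t' ∧ A (runAt A ω t') = i

/-- The run `ρ` and the adversary `A` are compatible: the process of each triplet is the one
that `A` chooses after the preceding triplets. -/
def Compatible {n : ℕ} (A : Adversary n) (ρ : Run n) : Prop :=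
  ∀ (t : ℕ) (h : t < ρ.length), A (ρ.take t) = (ρ[t]).p

/-- The transition `Try → Crit`, which ends a round. -/
def Triplet.EntersCrit {n : ℕ} (x : Triplet n) : Prop :=
  x.old = Region.Try ∧ x.new = Region.Crit

instance {n : ℕ} (x : Triplet n) : Decidable x.EntersCrit :=
  inferInstanceAs (Decidable (_ ∧ _))

/-- The step is a step of the trying code. This includes the step by which a process coming from
`Rem` starts to compete. -/
def Triplet.Tries {n : ℕ} (x : Triplet n) : Prop :=
  x.old = Region.Try ∨ x.new = Region.Try

/-- The number of rounds that are completed in a finite run. -/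
def rounds {n : ℕ} (ρ : Run n) : ℕ := ρ.countP fun x => decide x.EntersCrit

/-- `ρ` is a `k`-round run: it consists of exactly `k` complete rounds, so that it is empty or
ends with a transition `Try → Crit`. -/
def IsRoundRun {n : ℕ} (k : ℕ) (ρ : Run n) : Prop :=
  rounds ρ = k ∧ ∀ x ∈ ρ.getLast?, x.EntersCrit

/-- The event `π_k = ρ`: the execution has at least `k` rounds, and its run up to the end of
round `k`, i.e. of the first `t(k)` steps, is `ρ`. -/
def runEvent {n : ℕ} (A : Adversary n) (k : ℕ) (ρ : Run n) : Set (Source n) :=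
  {ω | ∃ t, IsRoundRun k (runAt A ω t) ∧ runAt A ω t = ρ}

/-- The event `W_i(k)`: process `i` enters the critical region at the end of round `k`. -/
def winEvent {n : ℕ} (A : Adversary n) (i : Fin n) (k : ℕ) : Set (Source n) :=
  {ω | ∃ t, rounds (runAt A ω t) + 1 = k ∧ (tripletAt A ω t).EntersCrit ∧
    (tripletAt A ω t).p = i}

/-- The event `i ∈ P(k)`: the execution has at least `k` rounds, and process `i` takes a step of
the trying code during round `k`. -/
def partEvent {n : ℕ} (A : Adversary n) (i : Fin n) (k : ℕ) : Set (Source n) :=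
  {ω | (∃ t, rounds (runAt A ω t) = k) ∧
    ∃ t, rounds (runAt A ω t) + 1 = k ∧ (tripletAt A ω t).Tries ∧ (tripletAt A ω t).p = i}

/-- The conditioning event `{π_{k-1} = ρ, i ∈ P(k)}`. -/
def condEvent {n : ℕ} (A : Adversary n) (i : Fin n) (k : ℕ) (ρ : Run n) : Set (Source n) :=
  runEvent A (k - 1) ρ ∩ partEvent A i k

/-- The conditional probability `P_A[W_i(k) | π_{k-1} = ρ, i ∈ P(k)]`. -/
def winProb {n : ℕ} (A : Adversary n) (i : Fin n) (k : ℕ) (ρ : Run n) : ℝ :=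
  ((sourceMeasure n)[|condEvent A i k ρ]).real (winEvent A i k)

/-- Weak, run-knowing, probabilistic no-lockout of the algorithm: a participating process wins
with conditional probability at least `c / n`, with a positive constant `c` that depends neither on
the number `n` of processes nor on the adversary, the round, the run or the process. -/
def WeakRunKnowingNoLockout : Prop :=
  ∃ c : ℝ, 0 < c ∧ ∀ (n : ℕ) (A : Adversary n), Fair A →
    ∀ k : ℕ, 1 ≤ k → ∀ ρ : Run n, IsRoundRun (k - 1) ρ → Compatible A ρ → ∀ i : Fin n,
      sourceMeasure n (condEvent A i k ρ) ≠ 0 → c / n ≤ winProb A i k ρ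

end Rabin

end

/-! A run records only regions, yet it can betray lottery numbers: a process that steps again with
the current round number and stays in `Try` holds less than the maximum. Let `b = maxLottery n` and
`m = n - b + 1`; process `0` is the victim, and a fixed time table suffices. In round one all tests
fail, so `1 ≤ d i < d m < d (m + 1) < ⋯ < d (n - 1) ≤ b` for `i < m`. The chain from `m` on has `b -
1` strictly increasing terms in `{2, …, b}`, hence everything is forced: `1` below `m`, then `2, …,
b` (`revealed_of_loses`).

Round two exploits the chance `1/100` that the new round number equals the old one. Then `m`,
holding `2` against the reset `V.B = 0`, redraws, while the others keep `1`. If `m` gets more than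
`1`, they all wait, `0` participates and `m` wins; if it gets `1`, process `1` enters before `0`
moves. So `0` participates with at least a constant conditional probability (`condEvent_real_ge`),
but never wins in this case. With a different round number everybody redraws, and `0` can win only
if `m` beats `1, …, m - 1` and `0` beats `m` (`draws_of_mem_winEvent`). Prescribing the two top
places costs `O(b / m ^ 2)` (`winEvent_real_le`).

The quotient is `O(log n / n ^ 2)`, which is `o(1 / n)`. This refutes every bound `c / n`, and is
below `e⁻³²` for large `n`; the remaining `n` are absorbed by taking `c` close to `1`. -/

noncomputable section

namespace Rabin

variable {n : ℕ}

/-! ### Executions under a fixed time table -/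

/-- The adversary that follows the time table `f`, whatever happens. -/
def oblivious (f : ℕ → Fin n) : Adversary n := fun ρ => f ρ.length

theorem runAt_zero (A : Adversary n) (ω : Source n) : runAt A ω 0 = [] := rfl

theorem runAt_succ (A : Adversary n) (ω : Source n) (t : ℕ) :
    runAt A ω (t + 1) = runAt A ω t ++ [tripletAt A ω t] := rfl

theorem runAt_eq_map (A : Adversary n) (ω : Source n) (t : ℕ) :
    runAt A ω t = (List.range t).map (tripletAt A ω) := by
  induction t with
  | zero => rfl
  | succ t ih => rw [runAt_succ, ih, List.range_succ, List.map_append]; rfl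

@[simp] theorem length_runAt (A : Adversary n) (ω : Source n) (t : ℕ) :
    (runAt A ω t).length = t := by
  simp [runAt_eq_map]

@[simp] theorem oblivious_runAt (f : ℕ → Fin n) (A : Adversary n) (ω : Source n) (t : ℕ) :
    oblivious f (runAt A ω t) = f t := by
  simp [oblivious]

theorem configAt_zero (A : Adversary n) (ω : Source n) :
    configAt A ω 0 = Config.init n (ω 0).2 := rfl

theorem configAt_succ (f : ℕ → Fin n) (ω : Source n) (t : ℕ) :
    configAt (oblivious f) ω (t + 1) =
      (configAt (oblivious f) ω t).step (f t) (ω (t + 1)) := by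
  have : configAt (oblivious f) ω (t + 1) = (configAt (oblivious f) ω t).step
      (oblivious f (runAt (oblivious f) ω t)) (ω (t + 1)) := rfl
  rw [this, oblivious_runAt]

theorem tripletAt_oblivious (f : ℕ → Fin n) (ω : Source n) (t : ℕ) :
    tripletAt (oblivious f) ω t = ⟨f t, (configAt (oblivious f) ω t).region (f t),
      (configAt (oblivious f) ω (t + 1)).region (f t)⟩ := by
  simp [tripletAt]

theorem rounds_runAt_succ (A : Adversary n) (ω : Source n) (t : ℕ) :
    rounds (runAt A ω (t + 1)) =
      rounds (runAt A ω t) + if (tripletAt A ω t).EntersCrit then 1 else 0 := by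
  rw [runAt_succ, rounds, List.countP_append, List.countP_singleton]
  simp [rounds]

theorem rounds_runAt_mono (A : Adversary n) (ω : Source n) :
    Monotone fun t => rounds (runAt A ω t) :=
  monotone_nat_of_le_succ fun t => by rw [rounds_runAt_succ]; exact Nat.le_add_right _ _

/-- Before a time at which the number of rounds is still what it was at time `s`, nobody enters
the critical region. -/
theorem not_entersCrit_of_rounds_eq (A : Adversary n) (ω : Source n) {s t u : ℕ}
    (h : rounds (runAt A ω u) = rounds (runAt A ω s)) (hst : s ≤ t) (htu : t < u) :
    ¬ (tripletAt A ω t).EntersCrit := by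
  intro hE
  have h1 := rounds_runAt_mono A ω hst
  have h2 := rounds_runAt_mono A ω (show t + 1 ≤ u from htu)
  have h3 := rounds_runAt_succ A ω t
  simp only [hE, if_true] at h1 h2 h3
  omega

/-- A time table that ends in a round robin is fair. -/
theorem fair_oblivious (f : ℕ → Fin n) (T : ℕ) (hf : ∀ t, T ≤ t → (f t : ℕ) = t % n) :
    Fair (oblivious f) := by
  intro ω t i _
  have hn : 0 < n := i.pos
  refine ⟨(T + t) * n + i, ?_, ?_⟩
  · nlinarith
  · rw [oblivious_runAt]
    apply Fin.ext
    rw [hf _ (by nlinarith), Nat.mul_add_mod_self_right, Nat.mod_eq_of_lt i.isLt]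

theorem compatible_oblivious (f : ℕ → Fin n) (ρ : Run n)
    (h : ∀ (t : ℕ) (ht : t < ρ.length), (ρ[t]).p = f t) : Compatible (oblivious f) ρ := by
  intro t ht
  rw [h t ht, oblivious, List.length_take, min_eq_left ht.le]

/-! ### The effect of a single step -/

namespace Config

variable (C : Config n) (i : Fin n) (ξ : Coin n)

/-- What the trying code does to a process that holds the current maximum. -/
theorem step_of_wins (hr : C.region i = .Try) (hS : C.S = 0) (hB : C.locB i = C.B)
    (hR : C.locR i = some C.R) :
    C.step i ξ = { C with S := 1, B := 0, R := ξ.2, region := Function.update C.region i .Crit } := by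
  simp [step, hr, tryStep, hS, hB, hR]

/-- A process that does not know the current round number draws. -/
theorem step_of_draws (hr : C.region i = .Try ∨ C.region i = .Rem)
    (hR : C.locR i ≠ some C.R) :
    C.step i ξ = { C with
      B := max C.B (ξ.1 : ℕ)
      locB := Function.update C.locB i (ξ.1 : ℕ)
      locR := Function.update C.locR i (some C.R)
      region := Function.update C.region i .Try } := by
  rcases hr with hr | hr <;> simp [step, hr, tryStep, Ne.symm hR]

/-- A process whose lottery number exceeds the shared one draws. -/
theorem step_of_lt (hr : C.region i = .Try) (hB : C.B < C.locB i) :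
    C.step i ξ = { C with
      B := max C.B (ξ.1 : ℕ)
      locB := Function.update C.locB i (ξ.1 : ℕ)
      locR := Function.update C.locR i (some C.R)
      region := Function.update C.region i .Try } := by
  simp [step, hr, tryStep, hB, hB.ne]

/-- A process in `Try` that knows the round number and has a smaller lottery number waits. -/
theorem step_of_waits (hr : C.region i = .Try) (hB : C.locB i < C.B)
    (hR : C.locR i = some C.R) : C.step i ξ = C := by
  simp [step, hr, tryStep, hB.ne', hR, hB.le, Function.update_eq_self_iff.2]

end Config

/-! ### A trivial execution for small `n` -/

/-- The time table in which process `0` runs twice, before a round robin. -/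
def soloTable (hn : 0 < n) (t : ℕ) : Fin n :=
  if t < 2 then ⟨0, hn⟩ else ⟨t % n, Nat.mod_lt _ hn⟩

/-- Whatever the coins, process `0` draws and then enters, so the condition is no restriction. For
small `n`, where the bound is at least one, a nonzero condition is all that is needed. -/
theorem condEvent_soloTable (hn : 0 < n) :
    condEvent (oblivious (soloTable hn)) ⟨0, hn⟩ 1 [] = Set.univ := by
  refine Set.eq_univ_of_forall fun ω => ?_
  have f0 : soloTable hn 0 = ⟨0, hn⟩ := rfl
  have f1 : soloTable hn 1 = ⟨0, hn⟩ := rfl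
  have h1 := configAt_succ (soloTable hn) ω 0
  rw [configAt_zero, f0, Config.step_of_draws _ _ _ (Or.inr rfl) (by simp [Config.init])] at h1
  have h2 := configAt_succ (soloTable hn) ω 1
  rw [f1, Config.step_of_wins _ _ _ (by simp [h1]) (by simp [h1, Config.init])
    (by simp [h1, Config.init]) (by simp [h1])] at h2
  have t0 : tripletAt (oblivious (soloTable hn)) ω 0 = ⟨⟨0, hn⟩, .Rem, .Try⟩ := by
    rw [tripletAt_oblivious, f0, h1]; simp [configAt_zero, Config.init]
  have t1 : tripletAt (oblivious (soloTable hn)) ω 1 = ⟨⟨0, hn⟩, .Try, .Crit⟩ := by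
    rw [tripletAt_oblivious, f1, h2, h1]; simp
  refine ⟨⟨0, ⟨rfl, by simp [runAt_zero]⟩, rfl⟩, ⟨2, ?_⟩, 0, rfl, ?_, ?_⟩
  · rw [rounds_runAt_succ, rounds_runAt_succ, t0, t1]
    simp [runAt_zero, rounds, Triplet.EntersCrit]
  · rw [t0]; exact Or.inr rfl
  · rw [t0]

/-! ### A lottery with a fixed round number -/

/-- The state of a lottery with round number `r` among the processes of `Q`: those of `P ⊆ Q` have
drawn the numbers `d`, the others are still in region `g` and do not know the round number. -/
structure Racing (C : Config n) (r : Fin 100) (g : Region) (d : Fin n → ℕ)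
    (Q P : Fin n → Prop) : Prop where
  S_eq : C.S = 0
  R_eq : C.R = r
  drawn : ∀ i, P i → C.region i = .Try ∧ C.locR i = some r ∧ C.locB i = d i ∧ d i ≤ C.B
  fresh : ∀ i, Q i → ¬ P i → C.region i = g ∧ C.locR i ≠ some r
  attained : C.B = 0 ∨ ∃ i, P i ∧ C.B = d i

namespace Racing

variable {C : Config n} {r : Fin 100} {g : Region} {d : Fin n → ℕ} {Q P : Fin n → Prop}
  {i : Fin n} {ξ : Coin n}

theorem draw (h : Racing C r g d Q P) (hg : g = .Try ∨ g = .Rem) (hQ : Q i) (hP : ¬ P i)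
    (hd : d i = ξ.1) :
    Racing (C.step i ξ) r g d Q (fun j => P j ∨ j = i) ∧ (C.step i ξ).region i = .Try := by
  obtain ⟨h1, h2⟩ := h.fresh i hQ hP
  have hS := h.S_eq
  have hR := h.R_eq
  rw [Config.step_of_draws _ _ _ (by rw [h1]; exact hg) (by rw [hR]; exact h2)]
  refine ⟨⟨hS, hR, fun j hj => ?_, fun j hQj hj => ?_, ?_⟩, by simp⟩
  · by_cases hji : j = i
    · subst hji; simp [hd, hR]
    · have := h.drawn j (hj.resolve_right hji)
      simp only [ne_eq, hji, not_false_eq_true, Function.update_of_ne]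
      exact ⟨this.1, this.2.1, this.2.2.1, le_max_of_le_left this.2.2.2⟩
  · push Not at hj
    have := h.fresh j hQj hj.1
    simpa [Function.update_of_ne hj.2] using this
  · right
    rcases le_total C.B (ξ.1 : ℕ) with hle | hle
    · exact ⟨i, Or.inr rfl, by simp [hle, hd]⟩
    · rcases h.attained with h0 | ⟨j, hj, hB⟩
      · exact ⟨i, Or.inr rfl, by simp only [hd]; omega⟩
      · exact ⟨j, Or.inl hj, by rw [← hB]; exact max_eq_left hle⟩

theorem lose (h : Racing C r g d Q P) (hi : P i) {j : Fin n} (hj : P j) (hij : d i < d j) :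
    C.step i ξ = C := by
  obtain ⟨h1, h2, h3, -⟩ := h.drawn i hi
  have := (h.drawn j hj).2.2.2
  exact Config.step_of_waits _ _ _ h1 (by omega) (by rw [h2, h.R_eq])

theorem B_eq (h : Racing C r g d Q P) (hi : P i) (hmax : ∀ j, P j → d j ≤ d i) : C.B = d i := by
  have h4 := (h.drawn i hi).2.2.2
  rcases h.attained with h0 | ⟨j, hj, hB⟩
  · omega
  · exact le_antisymm (hB ▸ hmax j hj) h4

theorem win (h : Racing C r g d Q P) (hi : P i) (hmax : ∀ j, P j → d j ≤ d i) :
    C.step i ξ = { C with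
      S := 1, B := 0, R := ξ.2, region := Function.update C.region i .Crit } := by
  obtain ⟨h1, h2, h3, h4⟩ := h.drawn i hi
  exact Config.step_of_wins _ _ _ h1 h.S_eq (by rw [h3, h.B_eq hi hmax]) (by rw [h2, h.R_eq])

theorem congr_drawn (h : Racing C r g d Q P) {P' : Fin n → Prop} (hP : ∀ i, P i ↔ P' i) :
    Racing C r g d Q P' := by
  have : P = P' := funext fun i => propext (hP i)
  exact this ▸ h

end Racing

/-- Between the times `a` and `T`, the time table `f` runs processes of `Q` only, and `e i` is the
time of the first step of process `i`. -/
structure FirstSteps (f : ℕ → Fin n) (e : Fin n → ℕ) (Q : Fin n → Prop) (a T : ℕ) : Prop where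
  mem : ∀ t, a ≤ t → t < T → Q (f t)
  le : ∀ t, a ≤ t → t < T → e (f t) ≤ t
  table : ∀ i, Q i → f (e i) = i

/-- If the step at time `t` is not a first step, then a larger number has been drawn before. -/
def Loses (f : ℕ → Fin n) (e : Fin n → ℕ) (Q : Fin n → Prop) (d : Fin n → ℕ) (t : ℕ) : Prop :=
  e (f t) < t → ∃ j, (Q j ∧ e j < t) ∧ d (f t) < d j

/-- The lottery numbers that are drawn at the times `e`. -/
def draws (ω : Source n) (e : Fin n → ℕ) (i : Fin n) : ℕ := (ω (e i + 1)).1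

section Lottery

variable {f : ℕ → Fin n} {e : Fin n → ℕ} {Q : Fin n → Prop} {a T : ℕ} {ω : Source n}
  {r : Fin 100} {g : Region}

/-- A first step draws and cannot enter `Crit`; a later step meets a larger number by `Loses` and
changes nothing. So the triplet is determined by the time table alone. -/
theorem racing_succ (hf : FirstSteps f e Q a T) (hg : g = .Try ∨ g = .Rem) {t : ℕ} (hat : a ≤ t)
    (htT : t < T)
    (h : Racing (configAt (oblivious f) ω t) r g (draws ω e) Q fun i => Q i ∧ e i < t)
    (hl : Loses f e Q (draws ω e) t) :
    (Racing (configAt (oblivious f) ω (t + 1)) r g (draws ω e) Q fun i => Q i ∧ e i < t + 1) ∧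
      tripletAt (oblivious f) ω t = ⟨f t, if e (f t) < t then .Try else g, .Try⟩ := by
  have hQ := hf.mem t hat htT
  rw [tripletAt_oblivious, configAt_succ]
  by_cases hlt : e (f t) < t
  · obtain ⟨j, hj, hij⟩ := hl hlt
    rw [h.lose ⟨hQ, hlt⟩ hj hij, (h.drawn _ ⟨hQ, hlt⟩).1, if_pos hlt]
    refine ⟨h.congr_drawn fun i => and_congr_right fun hi => ?_, rfl⟩
    have : e i ≠ t := fun hit => by have := hf.table i hi; rw [hit] at this; rw [this] at hlt; omega
    omega
  · have heq : e (f t) = t := le_antisymm (hf.le t hat htT) (not_lt.1 hlt)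
    obtain ⟨h1, h2⟩ := h.draw (ξ := ω (t + 1)) hg hQ (by simp [heq]) (by rw [draws, heq])
    rw [h2, (h.fresh _ hQ (by simp [heq])).1, if_neg hlt]
    refine ⟨h1.congr_drawn fun i => ⟨?_, fun ⟨hi, hit⟩ => ?_⟩, rfl⟩
    · rintro (⟨hi, hit⟩ | rfl)
      · exact ⟨hi, by omega⟩
      · exact ⟨hQ, by omega⟩
    · rcases Nat.lt_succ_iff_lt_or_eq.1 hit with hit | hit
      · exact Or.inl ⟨hi, hit⟩
      · right; rw [← hit, hf.table i hi]

theorem racing_of_loses (hf : FirstSteps f e Q a T) (hg : g = .Try ∨ g = .Rem)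
    (h : Racing (configAt (oblivious f) ω a) r g (draws ω e) Q fun i => Q i ∧ e i < a)
    {t : ℕ} (hat : a ≤ t) (htT : t ≤ T)
    (hl : ∀ s, a ≤ s → s < t → Loses f e Q (draws ω e) s) :
    Racing (configAt (oblivious f) ω t) r g (draws ω e) Q fun i => Q i ∧ e i < t := by
  induction t, hat using Nat.le_induction with
  | base => exact h
  | succ t hat ih =>
    exact (racing_succ hf hg hat htT (ih (by omega) fun s h1 h2 => hl s h1 (by omega))
      (hl t hat (by omega))).1

/-- The converse direction: a process that is tested while no larger number has been drawn holds the
value of `V.B` and would enter. The induction is strong because the invariant at time `s` rests on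
all earlier losses. -/
theorem loses_of_not_entersCrit (hf : FirstSteps f e Q a T) (hg : g = .Try ∨ g = .Rem)
    (h : Racing (configAt (oblivious f) ω a) r g (draws ω e) Q fun i => Q i ∧ e i < a)
    {t : ℕ} (htT : t ≤ T)
    (hl : ∀ s, a ≤ s → s < t → ¬ (tripletAt (oblivious f) ω s).EntersCrit) :
    ∀ s, a ≤ s → s < t → Loses f e Q (draws ω e) s := by
  intro s
  induction s using Nat.strong_induction_on with
  | _ s ih =>
    intro has hst hlt
    by_contra hmax
    push Not at hmax
    have hr := racing_of_loses hf hg h has (by omega)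
      fun u h1 h2 => ih u h2 h1 (by omega)
    have hQ := hf.mem s has (by omega)
    apply hl s has hst
    rw [tripletAt_oblivious, configAt_succ, hr.win ⟨hQ, hlt⟩ hmax, (hr.drawn _ ⟨hQ, hlt⟩).1]
    simp [Triplet.EntersCrit]

end Lottery

/-! ### Round one: a run that reveals the lottery numbers -/

/-- The time table: in round one, the processes up to `m` draw, those below `m` are tested, then
the processes after `m` draw in turn, each draw being followed by a test of the preceding process,
and `n - 1` enters the critical region. In round two, `m` draws first, then every process between
`1` and `m - 1` takes two steps, and then `0` and `m` take one step each. -/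
def timeTableNat (n m t : ℕ) : ℕ :=
  if t ≤ m then t
  else if t < 2 * m + 1 then t - m - 1
  else if t < 2 * n - 1 then (if t % 2 = 1 then (t + 1) / 2 else t / 2 - 1)
  else if t ≤ 2 * n then n - 1
  else if t = 2 * n + 1 then m
  else if t < 2 * n + 2 * m then (t - 2 * n) / 2
  else if t = 2 * n + 2 * m then 0
  else if t = 2 * n + 2 * m + 1 then m
  else t % n

theorem timeTableNat_lt {n m : ℕ} (hm : m < n) (t : ℕ) : timeTableNat n m t < n := by
  unfold timeTableNat
  have := Nat.mod_lt t (show 0 < n by omega)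
  split_ifs <;> omega

/-- The time table as a map to processes. -/
def timeTable {m : ℕ} (hm : m < n) (t : ℕ) : Fin n := ⟨timeTableNat n m t, timeTableNat_lt hm t⟩

/-- The time of the first step of a process in round one. -/
def firstTime (m : ℕ) (i : Fin n) : ℕ := if (i : ℕ) ≤ m then i else 2 * i - 1

/-- The lottery numbers which the run of round one reveals. -/
def revealed (m : ℕ) (i : Fin n) : ℕ := if (i : ℕ) < m then 1 else i - m + 2

/-- The run of round one. -/
def revealingRun {m : ℕ} (hm : m < n) : Run n :=
  (List.range (2 * n)).map fun t => ⟨timeTable hm t,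
    if firstTime m (timeTable hm t) < t then .Try else .Rem, if t = 2 * n - 1 then .Crit else .Try⟩

section RoundOne

variable {m : ℕ} (hm : m < n)

theorem timeTable_win : timeTable hm (2 * n - 1) = ⟨n - 1, by omega⟩ := by
  apply Fin.ext
  simp only [timeTable, timeTableNat]
  split_ifs <;> omega

theorem timeTable_exit : timeTable hm (2 * n) = ⟨n - 1, by omega⟩ := by
  apply Fin.ext
  simp only [timeTable, timeTableNat]
  split_ifs <;> omega

theorem firstSteps_one (hm0 : 2 ≤ m) :
    FirstSteps (timeTable hm) (firstTime m) (fun _ => True) 0 (2 * n - 1) where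
  mem _ _ _ := trivial
  le t _ ht := by
    simp only [firstTime, timeTable, timeTableNat]
    split_ifs <;> omega
  table i _ := by
    apply Fin.ext
    have := i.isLt
    simp only [firstTime, timeTable, timeTableNat]
    split_ifs <;> omega

theorem racing_init (ω : Source n) (A : Adversary n) (d : Fin n → ℕ) {Q P : Fin n → Prop}
    (hP : ∀ i, ¬ P i) : Racing (configAt A ω 0) (ω 0).2 .Rem d Q P :=
  ⟨rfl, rfl, fun i h => absurd h (hP i), fun _ _ _ => ⟨rfl, by simp [configAt_zero, Config.init]⟩,
    Or.inl rfl⟩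

theorem loses_revealed (hm0 : 2 ≤ m) {d : Fin n → ℕ} (hd : d = revealed m) {t : ℕ}
    (ht : t < 2 * n - 1) : Loses (timeTable hm) (firstTime m) (fun _ => True) d t := by
  intro hlt
  subst hd
  have key : ∃ j : ℕ, ∃ hj : j < n, firstTime m ⟨j, hj⟩ < t ∧
      revealed m (timeTable hm t) < revealed m ⟨j, hj⟩ := by
    by_cases h1 : t < 2 * m + 1
    · refine ⟨m, hm, ?_⟩
      simp only [firstTime, timeTable, timeTableNat, revealed] at hlt ⊢
      split_ifs at hlt ⊢ <;> omega
    · refine ⟨t / 2, by omega, ?_⟩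
      simp only [firstTime, timeTable, timeTableNat, revealed] at hlt ⊢
      split_ifs at hlt ⊢ <;> omega
  obtain ⟨j, hj, h1, h2⟩ := key
  exact ⟨⟨j, hj⟩, ⟨trivial, h1⟩, h2⟩

/-- The numbers from `m` to `n - 1` increase strictly, start at `2` or more and end at `n - m + 1`
or less. There are `n - m` of them, so there is no slack. -/
theorem revealed_of_loses (hm0 : 2 ≤ m) {d : Fin n → ℕ} (h1 : ∀ i, 1 ≤ d i)
    (h2 : ∀ i, d i ≤ n - m + 1)
    (hl : ∀ t, t < 2 * n - 1 → Loses (timeTable hm) (firstTime m) (fun _ => True) d t) :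
    d = revealed m := by
  have hgroup : ∀ i : Fin n, (i : ℕ) < m → ∃ j : Fin n, (j : ℕ) ≤ m ∧ d i < d j := by
    intro i hi
    have hi' : timeTable hm (m + 1 + i) = i := by
      apply Fin.ext
      simp only [timeTable, timeTableNat]
      split_ifs <;> omega
    have h := hl (m + 1 + i) (by omega)
    rw [Loses, hi'] at h
    obtain ⟨j, ⟨-, hj⟩, hij⟩ := h (by simp only [firstTime]; split_ifs <;> omega)
    refine ⟨j, ?_, hij⟩
    simp only [firstTime] at hj
    split_ifs at hj <;> omega
  -- A maximum attained below `m` would be beaten inside the group, by `hgroup`; hence it is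
  -- attained at `m`.
  have hmax : ∀ i : Fin n, (i : ℕ) ≤ m → d i ≤ d ⟨m, hm⟩ := by
    obtain ⟨i₀, hi₀, hmax⟩ := Finset.exists_max_image
      (Finset.univ.filter fun i : Fin n => (i : ℕ) ≤ m) d ⟨⟨m, hm⟩, by simp⟩
    simp only [Finset.mem_filter, Finset.mem_univ, true_and] at hi₀ hmax
    rcases hi₀.lt_or_eq with hlt | heq
    · obtain ⟨j, hj, hij⟩ := hgroup i₀ hlt
      exact absurd (hmax j hj) (by omega)
    · have : i₀ = ⟨m, hm⟩ := Fin.ext heq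
      exact this ▸ hmax
  -- When `m + k` is tested, only `m + k + 1` has drawn since the maximum was at `m + k`.
  have hchain : ∀ k (hk : m + k < n), (∀ j : Fin n, (j : ℕ) ≤ m + k → d j ≤ d ⟨m + k, hk⟩) →
      ∀ hk' : m + k + 1 < n, d ⟨m + k, hk⟩ < d ⟨m + k + 1, hk'⟩ := by
    intro k hk hle hk'
    have hi' : timeTable hm (2 * (m + k) + 2) = ⟨m + k, hk⟩ := by
      apply Fin.ext
      simp only [timeTable, timeTableNat]
      split_ifs <;> omega
    have h := hl (2 * (m + k) + 2) (by omega)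
    rw [Loses, hi'] at h
    obtain ⟨j, ⟨-, hj⟩, hij⟩ := h (by simp only [firstTime]; split_ifs <;> omega)
    have hj' : (j : ℕ) ≤ m + k + 1 := by
      simp only [firstTime] at hj
      split_ifs at hj <;> omega
    rcases hj'.lt_or_eq with hlt | heq
    · exact absurd (hle j (by omega)) (by omega)
    · have : j = ⟨m + k + 1, hk'⟩ := Fin.ext heq
      exact this ▸ hij
  have hlow : ∀ k (hk : m + k < n), (∀ j : Fin n, (j : ℕ) ≤ m + k → d j ≤ d ⟨m + k, hk⟩) ∧
      k + 2 ≤ d ⟨m + k, hk⟩ := by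
    intro k
    induction k with
    | zero =>
      intro hk
      refine ⟨hmax, ?_⟩
      obtain ⟨j, hj, hij⟩ := hgroup ⟨0, by omega⟩ (by simp; omega)
      have := hmax j hj
      have := h1 ⟨0, by omega⟩
      simp only [add_zero]
      omega
    | succ k ih =>
      intro hk
      obtain ⟨ih1, ih2⟩ := ih (by omega)
      have hlt := hchain k (by omega) ih1 hk
      refine ⟨fun j hj => ?_, by simp only [← add_assoc]; omega⟩
      rcases hj.lt_or_eq with hj | hj
      · exact (ih1 j (by omega)).trans hlt.le
      · have : j = ⟨m + (k + 1), hk⟩ := Fin.ext hj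
        rw [this]
  -- Downward induction from `n - 1`; `l` counts the processes after `m + k`.
  have hhigh : ∀ l k (hk : m + k < n), m + k + l + 1 = n → d ⟨m + k, hk⟩ ≤ k + 2 := by
    intro l
    induction l with
    | zero =>
      intro k hk hkn
      have := h2 ⟨m + k, hk⟩
      omega
    | succ l ih =>
      intro k hk hkn
      have hlt := hchain k hk (hlow k hk).1 (by omega)
      have := ih (k + 1) (by omega) (by omega)
      simp only [← add_assoc] at this
      omega
  funext i
  have hi := i.isLt
  rw [revealed]
  split_ifs with him
  · obtain ⟨j, hj, hij⟩ := hgroup i him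
    have := hmax j hj
    have := hhigh (n - m - 1) 0 hm (by omega)
    have := h1 i
    simp only [add_zero] at *
    omega
  · obtain ⟨k, hk⟩ := Nat.exists_eq_add_of_le (not_lt.1 him)
    have hik : i = ⟨m + k, by omega⟩ := Fin.ext hk
    have ha := (hlow k (by omega)).2
    have hb := hhigh (n - m - k - 1) k (by omega) (by omega)
    rw [hik]
    simp only
    omega

/-- The state at the beginning of the lottery of round two: `r` is the old round number. -/
structure Revealed (C : Config n) (m : ℕ) (r : Fin 100) : Prop where
  S_eq : C.S = 0
  B_eq : C.B = 0
  group : ∀ i : Fin n, (i : ℕ) ≤ m →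
    C.region i = .Try ∧ C.locR i = some r ∧ C.locB i = revealed m i

variable {ω : Source n}

theorem racing_roundOne (hm0 : 2 ≤ m) (hd : draws ω (firstTime m) = revealed m) {t : ℕ}
    (ht : t ≤ 2 * n - 1) :
    Racing (configAt (oblivious (timeTable hm)) ω t) (ω 0).2 .Rem (draws ω (firstTime m))
      (fun _ => True) fun i => True ∧ firstTime m i < t :=
  racing_of_loses (firstSteps_one hm hm0) (Or.inr rfl)
    (racing_init ω _ _ fun i => by simp) (Nat.zero_le _) ht
    fun s _ hs => loses_revealed hm hm0 hd (by omega)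

/-- As `m + 1 < n`, the winner `n - 1` is outside the group, whose members keep their numbers and
the old round number. The new round number comes from coin `2 * n`, since step `t` reads coin `t +
1`. -/
theorem configAt_endRoundOne (hm0 : 2 ≤ m) (hmn : m + 1 < n)
    (hd : draws ω (firstTime m) = revealed m) :
    tripletAt (oblivious (timeTable hm)) ω (2 * n - 1) = ⟨⟨n - 1, by omega⟩, .Try, .Crit⟩ ∧
    Revealed (configAt (oblivious (timeTable hm)) ω (2 * n + 1)) m (ω 0).2 ∧
    (configAt (oblivious (timeTable hm)) ω (2 * n + 1)).R = (ω (2 * n)).2 := by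
  have hlast := timeTable_win hm
  have hlast' := timeTable_exit hm
  have hr := racing_roundOne hm hm0 hd (t := 2 * n - 1) le_rfl
  have hP : ∀ i : Fin n, True ∧ firstTime m i < 2 * n - 1 := fun i => ⟨trivial, by
    have := i.isLt
    simp only [firstTime]
    split_ifs <;> omega⟩
  have htr := tripletAt_oblivious (timeTable hm) ω (2 * n - 1)
  rw [show 2 * n - 1 + 1 = 2 * n by omega] at htr
  have hs1 := configAt_succ (timeTable hm) ω (2 * n - 1)
  rw [show 2 * n - 1 + 1 = 2 * n by omega, hlast, hr.win (hP _) fun j _ => by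
    rw [hd]
    simp only [revealed]
    split_ifs <;> omega] at hs1
  have hs2 := configAt_succ (timeTable hm) ω (2 * n)
  have hcrit : (configAt (oblivious (timeTable hm)) ω (2 * n)).region ⟨n - 1, by omega⟩ = .Crit := by
    rw [hs1]; simp
  rw [hlast', Config.step, hcrit] at hs2
  refine ⟨?_, ⟨?_, ?_, fun i hi => ?_⟩, ?_⟩
  · rw [htr, hlast, hcrit, (hr.drawn _ (hP _)).1]
  · rw [hs2]
  · rw [hs2, hs1]
  · have hne : i ≠ ⟨n - 1, by omega⟩ := fun h => by rw [h] at hi; simp at hi; omega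
    obtain ⟨a1, a2, a3, -⟩ := hr.drawn i (hP i)
    rw [hs2, hs1]
    simp [Function.update_of_ne hne, a1, a2, a3, hd]
  · rw [hs2, hs1]

theorem runAt_eq_revealingRun (hm0 : 2 ≤ m) (hmn : m + 1 < n)
    (hd : draws ω (firstTime m) = revealed m) :
    runAt (oblivious (timeTable hm)) ω (2 * n) = revealingRun hm := by
  rw [runAt_eq_map, revealingRun]
  refine List.map_congr_left fun t ht => ?_
  rw [List.mem_range] at ht
  by_cases hlast : t = 2 * n - 1
  · rw [hlast, (configAt_endRoundOne hm hm0 hmn hd).1, if_pos rfl, if_pos]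
    · rw [timeTable_win]
    · have := (timeTable hm (2 * n - 1)).isLt
      simp only [firstTime]
      split_ifs <;> omega
  · rw [if_neg hlast]
    exact (racing_succ (firstSteps_one hm hm0) (Or.inr rfl) (Nat.zero_le _) (by omega)
      (racing_roundOne hm hm0 hd (by omega)) (loses_revealed hm hm0 hd (by omega))).2

theorem isRoundRun_revealingRun : IsRoundRun 1 (revealingRun hm) := by
  obtain ⟨k, hk⟩ : ∃ k, 2 * n = k + 1 := ⟨2 * n - 1, by omega⟩
  have hlast : firstTime m (timeTable hm k) < k := by
    have h1 := (timeTable hm k).isLt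
    simp only [firstTime, timeTable, timeTableNat] at h1 ⊢
    split_ifs at h1 ⊢ <;> omega
  rw [revealingRun, hk, List.range_succ, List.map_append]
  constructor
  · rw [rounds, List.countP_append, List.countP_eq_zero.2]
    · simp [Triplet.EntersCrit, hlast]
    · intro x hx
      obtain ⟨t, ht, rfl⟩ := List.mem_map.1 hx
      rw [List.mem_range] at ht
      simp [Triplet.EntersCrit, ht.ne]
  · simp [Triplet.EntersCrit, hlast]

theorem compatible_revealingRun : Compatible (oblivious (timeTable hm)) (revealingRun hm) :=
  compatible_oblivious _ _ fun t ht => by simp [revealingRun]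

theorem fair_timeTable : Fair (oblivious (timeTable hm)) :=
  fair_oblivious _ (2 * n + 2 * m + 2) fun t ht => by
    simp only [timeTable, timeTableNat]
    split_ifs <;> omega

/-- With `hmb` the run and the draws of round one determine each other, so conditioning on the run
is conditioning on finitely many coins. -/
theorem runEvent_revealingRun (hm0 : 2 ≤ m) (hmn : m + 1 < n) (hmb : maxLottery n = n - m + 1) :
    runEvent (oblivious (timeTable hm)) 1 (revealingRun hm) =
      {ω | draws ω (firstTime m) = revealed m} := by
  ext ω
  constructor
  · rintro ⟨t, -, ht⟩
    have hlen := congrArg List.length ht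
    simp only [length_runAt, revealingRun, List.length_map, List.length_range] at hlen
    subst hlen
    rw [runAt_eq_map, revealingRun, List.map_inj_left] at ht
    refine revealed_of_loses hm hm0 (fun i => (Finset.mem_Icc.1 (ω _).1.2).1)
      (fun i => hmb ▸ (Finset.mem_Icc.1 (ω _).1.2).2) fun t htn => ?_
    refine loses_of_not_entersCrit (firstSteps_one hm hm0) (Or.inr rfl)
      (racing_init ω _ _ fun i => by simp) le_rfl (fun s _ hs => ?_) t (Nat.zero_le _) htn
    rw [ht s (List.mem_range.2 (by omega))]
    simp [Triplet.EntersCrit, hs.ne]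
  · intro hd
    have h := runAt_eq_revealingRun hm hm0 hmn hd
    exact ⟨2 * n, h ▸ isRoundRun_revealingRun hm, h⟩

end RoundOne

theorem rounds_eq_of_not_entersCrit {n : ℕ} (A : Adversary n) (ω : Source n) {s u : ℕ}
    (hsu : s ≤ u) (h : ∀ t, s ≤ t → t < u → ¬ (tripletAt A ω t).EntersCrit) :
    rounds (runAt A ω u) = rounds (runAt A ω s) := by
  induction u, hsu using Nat.le_induction with
  | base => rfl
  | succ u hsu ih =>
    rw [rounds_runAt_succ, if_neg (h u hsu (by omega)), add_zero,
      ih fun t h1 h2 => h t h1 (by omega)]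

theorem entersCrit_of_wins {n : ℕ} {f : ℕ → Fin n} {ω : Source n} {t : ℕ} {i : Fin n}
    {C : Config n} (hC : configAt (oblivious f) ω t = C) (hi : f t = i) (hr : C.region i = .Try)
    (hS : C.S = 0) (hB : C.locB i = C.B) (hR : C.locR i = some C.R) :
    (tripletAt (oblivious f) ω t).EntersCrit := by
  rw [tripletAt_oblivious, configAt_succ, hC, hi, Config.step_of_wins _ _ _ hr hS hB hR]
  simp [Triplet.EntersCrit, hr]

/-! ### Round two: who can win -/

section RoundTwo

variable {m : ℕ} (hm : m < n) {ω : Source n}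

/-- The time of the first step of a process in the lottery of round two. -/
def secondTime (m : ℕ) (i : Fin n) : ℕ :=
  if (i : ℕ) = m then 2 * n + 1 else if (i : ℕ) = 0 then 2 * n + 2 * m else 2 * n + 2 * i

theorem timeTableNat_two (hm : m < n) {t : ℕ} (h1 : 2 * n < t) (h2 : t < 2 * n + 2 * m + 2) :
    timeTableNat n m t = if t = 2 * n + 1 ∨ t = 2 * n + 2 * m + 1 then m else
      if t = 2 * n + 2 * m then 0 else t / 2 - n := by
  rw [timeTableNat, if_neg (by omega), if_neg (by omega), if_neg (by omega), if_neg (by omega)]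
  split_ifs <;> omega

theorem firstSteps_two (hm0 : 2 ≤ m) :
    FirstSteps (timeTable hm) (secondTime m) (fun i => (i : ℕ) ≤ m) (2 * n + 1)
      (2 * n + 2 * m + 2) where
  mem t h1 h2 := by
    simp only [timeTable, timeTableNat_two hm h1 h2]
    split_ifs <;> omega
  le t h1 h2 := by
    simp only [secondTime, timeTable, timeTableNat_two hm h1 h2]
    split_ifs <;> omega
  table i hi := by
    apply Fin.ext
    have h1 : 2 * n < secondTime m i := by simp only [secondTime]; split_ifs <;> omega
    have h2 : secondTime m i < 2 * n + 2 * m + 2 := by simp only [secondTime]; split_ifs <;> omega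
    simp only [timeTable, timeTableNat_two hm h1 h2]
    simp only [secondTime]
    split_ifs <;> omega

theorem timeTable_first : timeTable hm (2 * n + 1) = ⟨m, hm⟩ :=
  Fin.ext <| by simp [timeTable, timeTableNat_two hm (t := 2 * n + 1) (by omega) (by omega)]

theorem timeTable_test (k : ℕ) (hk0 : 0 < k) (hkm : k < m) (r : ℕ) (hr : r < 2) :
    timeTable hm (2 * n + 2 * k + r) = ⟨k, by omega⟩ := by
  apply Fin.ext
  simp only [timeTable, timeTableNat_two hm (t := 2 * n + 2 * k + r) (by omega) (by omega)]
  split_ifs <;> omega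

theorem timeTable_zero (hm0 : 2 ≤ m) : timeTable hm (2 * n + 2 * m) = ⟨0, by omega⟩ := by
  apply Fin.ext
  simp only [timeTable, timeTableNat_two hm (t := 2 * n + 2 * m) (by omega) (by omega)]
  split_ifs <;> omega

theorem timeTable_last : timeTable hm (2 * n + 2 * m + 1) = ⟨m, hm⟩ :=
  Fin.ext <| by
    simp [timeTable, timeTableNat_two hm (t := 2 * n + 2 * m + 1) (by omega) (by omega)]

theorem draws_secondTime : draws ω (secondTime m) ⟨m, hm⟩ = (ω (2 * n + 1 + 1)).1 := by
  simp [draws, secondTime]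

/-- If the new round number is the old one, then `m` draws, and all the others keep the lottery
number `1`. -/
theorem configAt_of_sameRound (hm0 : 2 ≤ m) (hmn : m + 1 < n)
    (hd : draws ω (firstTime m) = revealed m) (hR : (ω (2 * n)).2 = (ω 0).2) :
    ∃ C : Config n, C.S = 0 ∧ C.R = (ω 0).2 ∧ C.B = draws ω (secondTime m) ⟨m, hm⟩ ∧
      C.locB ⟨m, hm⟩ = C.B ∧
      (∀ i : Fin n, (i : ℕ) ≤ m → C.region i = .Try ∧ C.locR i = some (ω 0).2) ∧
      (∀ i : Fin n, (i : ℕ) < m → C.locB i = 1) ∧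
      configAt (oblivious (timeTable hm)) ω (2 * n + 2) = C ∧
      (1 < C.B → ∀ t, 2 * n + 2 ≤ t → t ≤ 2 * n + 2 * m + 1 →
        configAt (oblivious (timeTable hm)) ω t = C) := by
  obtain ⟨-, ⟨h1, h2, h3⟩, h4⟩ := configAt_endRoundOne hm hm0 hmn hd
  have hs := configAt_succ (timeTable hm) ω (2 * n + 1)
  obtain ⟨b1, b2, b3⟩ := h3 ⟨m, hm⟩ le_rfl
  -- `V.B` has been reset to `0` while `m` still holds `2`, so `m` redraws although it knows the
  -- round number.
  rw [timeTable_first, Config.step_of_lt _ _ _ b1 (by rw [b3, h2]; simp [revealed])] at hs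
  refine ⟨_, ?_, ?_, ?_, ?_, fun i hi => ?_, fun i hi => ?_, hs, ?_⟩
  · exact h1
  · exact h4.trans hR
  · simp [h2, draws_secondTime]
  · simp [h2]
  · by_cases him : i = ⟨m, hm⟩
    · subst him; simp [h4, hR]
    · simpa [Function.update_of_ne him] using ⟨(h3 i hi).1, (h3 i hi).2.1⟩
  · have him : i ≠ ⟨m, hm⟩ := fun h => by simp [h] at hi
    simp [Function.update_of_ne him, (h3 i hi.le).2.2, revealed, hi]
  · intro hB t ht1
    induction t, ht1 using Nat.le_induction with
    | base => exact fun _ => hs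
    | succ t ht1 ih =>
      intro ht
      have hi : (timeTable hm t : ℕ) < m := by
        simp only [timeTable, timeTableNat_two hm (t := t) (by omega) (by omega)]
        split_ifs <;> omega
      have him : timeTable hm t ≠ ⟨m, hm⟩ := fun h => by simp [h] at hi
      rw [configAt_succ, ih (by omega)]
      obtain ⟨b1, b2, b3⟩ := h3 _ hi.le
      apply Config.step_of_waits
      · simpa [Function.update_of_ne him] using b1
      · simp only [Function.update_of_ne him, b3, revealed, hi, if_true]
        exact hB
      · simpa [Function.update_of_ne him, h4, hR] using b2

theorem not_entersCrit_exit (hm0 : 2 ≤ m) (hmn : m + 1 < n)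
    (hd : draws ω (firstTime m) = revealed m) :
    ¬ (tripletAt (oblivious (timeTable hm)) ω (2 * n)).EntersCrit := by
  have h1 := (configAt_endRoundOne hm hm0 hmn hd).1
  rw [tripletAt_oblivious, show 2 * n - 1 + 1 = 2 * n by omega] at h1
  rw [timeTable_win] at h1
  rw [tripletAt_oblivious, timeTable_exit, (Triplet.mk.inj h1).2.2]
  simp [Triplet.EntersCrit]

/-- The draw `2` exceeds every `1` in the group, so nobody enters before `0` has stepped. The return
of `m` at time `2 * n + 2 * m + 1` then completes the round, as `partEvent` requires. -/
theorem mem_partEvent_of_sameRound (hm0 : 2 ≤ m) (hmn : m + 1 < n)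
    (hd : draws ω (firstTime m) = revealed m) (hR : (ω (2 * n)).2 = (ω 0).2)
    (hv : draws ω (secondTime m) ⟨m, hm⟩ = 2) :
    ω ∈ partEvent (oblivious (timeTable hm)) ⟨0, by omega⟩ 2 := by
  obtain ⟨C, h1, h2, h3, h4, h5, h6, h7, h8⟩ := configAt_of_sameRound hm hm0 hmn hd hR
  specialize h8 (by omega)
  have hone : rounds (runAt (oblivious (timeTable hm)) ω (2 * n)) = 1 := by
    rw [runAt_eq_revealingRun hm hm0 hmn hd]
    exact (isRoundRun_revealingRun hm).1
  have hnew : ∀ t, 2 * n + 1 ≤ t → t < 2 * n + 2 * m + 1 →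
      (tripletAt (oblivious (timeTable hm)) ω t).new = .Try := by
    intro t ht1 ht2
    rw [tripletAt_oblivious, h8 (t + 1) (by omega) (by omega)]
    exact (h5 _ ((firstSteps_two hm hm0).mem t ht1 (by omega))).1
  have hwait : ∀ t, 2 * n ≤ t → t ≤ 2 * n + 2 * m + 1 →
      rounds (runAt (oblivious (timeTable hm)) ω t) = 1 := by
    intro t ht1 ht2
    rw [rounds_eq_of_not_entersCrit _ _ ht1, hone]
    intro s hs1 hs2
    rcases hs1.eq_or_lt with rfl | hs1
    · exact not_entersCrit_exit hm hm0 hmn hd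
    · intro hE
      have := hnew s hs1 (by omega)
      rw [hE.2] at this
      exact absurd this (by simp)
  refine ⟨⟨2 * n + 2 * m + 2, ?_⟩, 2 * n + 2 * m, ?_, ?_, ?_⟩
  · rw [rounds_runAt_succ, hwait _ (by omega) le_rfl, if_pos]
    exact entersCrit_of_wins (h8 _ (by omega) le_rfl) (timeTable_last hm) (h5 _ le_rfl).1 h1 h4
      (by rw [(h5 _ le_rfl).2, h2])
  · rw [hwait _ (by omega) (by omega)]
  · exact Or.inr (hnew _ (by omega) (by omega))
  · rw [tripletAt_oblivious, timeTable_zero hm hm0]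

/-- Process `0` wins round two only if it has the largest number, and `m` the second largest. -/
theorem draws_of_mem_winEvent (hm0 : 2 ≤ m) (hmn : m + 1 < n)
    (hd : draws ω (firstTime m) = revealed m)
    (hw : ω ∈ winEvent (oblivious (timeTable hm)) ⟨0, by omega⟩ 2) :
    (∀ i : Fin n, 0 < (i : ℕ) → (i : ℕ) < m →
      draws ω (secondTime m) i < draws ω (secondTime m) ⟨m, hm⟩) ∧
    draws ω (secondTime m) ⟨m, hm⟩ < draws ω (secondTime m) ⟨0, by omega⟩ := by
  obtain ⟨t, ht, hE, hp⟩ := hw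
  have hone : rounds (runAt (oblivious (timeTable hm)) ω (2 * n)) = 1 := by
    rw [runAt_eq_revealingRun hm hm0 hmn hd]
    exact (isRoundRun_revealingRun hm).1
  have htn : 2 * n ≤ t := by
    by_contra hlt
    have h1 := rounds_runAt_mono (oblivious (timeTable hm)) ω (show t + 1 ≤ 2 * n by omega)
    have h2 := rounds_runAt_succ (oblivious (timeTable hm)) ω t
    rw [if_pos hE] at h2
    simp only at h1
    omega
  have hno : ∀ s, 2 * n ≤ s → s < t → ¬ (tripletAt (oblivious (timeTable hm)) ω s).EntersCrit :=
    fun s => not_entersCrit_of_rounds_eq _ _ (by omega)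
  rw [tripletAt_oblivious] at hp
  have hp' : timeTableNat n m t = 0 := congrArg Fin.val hp
  -- Process `0` has a single scheduled step in round two; any other chance lies in the final round
  -- robin.
  have htm : t = 2 * n + 2 * m ∨ 2 * n + 2 * m + 2 ≤ t := by
    simp only [timeTableNat] at hp'
    split_ifs at hp' <;> omega
  by_cases hR : (ω (2 * n)).2 = (ω 0).2
  · obtain ⟨C, h1, h2, h3, h4, h5, h6, h7, h8⟩ := configAt_of_sameRound hm hm0 hmn hd hR
    exfalso
    have hpos : 1 ≤ draws ω (secondTime m) ⟨m, hm⟩ := (Finset.mem_Icc.1 (ω _).1.2).1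
    rcases (h3 ▸ hpos : 1 ≤ C.B).eq_or_lt with hB | hB
    · apply hno (2 * n + 2) (by omega) (by omega)
      have hi := timeTable_test hm 1 (by omega) (by omega) 0 (by omega)
      have h5' := h5 ⟨1, by omega⟩ (by simp; omega)
      exact entersCrit_of_wins h7 hi h5'.1 h1 (by rw [h6 _ (by simp; omega), hB])
        (by rw [h5'.2, h2])
    · specialize h8 hB
      rcases htm with rfl | htm
      · have hnew := hE.2
        rw [tripletAt_oblivious, timeTable_zero hm hm0, h8 _ (by omega) le_rfl] at hnew
        have := (h5 ⟨0, by omega⟩ (by simp)).1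
        simp only at hnew
        rw [this] at hnew
        cases hnew
      -- Otherwise `m` still holds the maximum at its return and enters before the round robin.
      · apply hno (2 * n + 2 * m + 1) (by omega) (by omega)
        exact entersCrit_of_wins (h8 _ (by omega) le_rfl) (timeTable_last hm) (h5 _ le_rfl).1 h1
          h4 (by rw [(h5 _ le_rfl).2, h2])
  · obtain ⟨-, ⟨h1, h2, h3⟩, h4⟩ := configAt_endRoundOne hm hm0 hmn hd
    have hnone : ∀ i : Fin n, ¬ secondTime m i < 2 * n + 1 := fun i => by
      simp only [secondTime]
      split_ifs <;> omega
    have hr : Racing (configAt (oblivious (timeTable hm)) ω (2 * n + 1)) (ω (2 * n)).2 .Try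
        (draws ω (secondTime m)) (fun i => (i : ℕ) ≤ m)
        fun i => (i : ℕ) ≤ m ∧ secondTime m i < 2 * n + 1 :=
      ⟨h1, h4, fun i hi => absurd hi.2 (hnone i), fun i hi _ => ⟨(h3 i hi).1, by
        rw [(h3 i hi).2.1]
        simpa using Ne.symm hR⟩, Or.inl h2⟩
    have hf := firstSteps_two hm hm0
    rcases htm with rfl | htm
    · exfalso
      -- This is the first step of `0` since the round number changed, so it draws and stays in
      -- `Try`.
      have hl := loses_of_not_entersCrit hf (Or.inl rfl) hr (t := 2 * n + 2 * m) (by omega)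
        fun s hs1 hs2 => hno s (by omega) hs2
      have hr' := racing_of_loses hf (Or.inl rfl) hr (by omega) (by omega) hl
      have := (racing_succ hf (Or.inl rfl) (by omega) (by omega) hr' fun hlt => by
        rw [timeTable_zero hm hm0] at hlt
        simp [secondTime, show 0 ≠ m by omega] at hlt).2
      have hnew := hE.2
      rw [this] at hnew
      cases hnew
    · have hl := loses_of_not_entersCrit hf (Or.inl rfl) hr le_rfl
        fun s hs1 hs2 => hno s (by omega) (by omega)
      -- At the test of `k`, only `m` and `1, …, k` have drawn. Whoever beats `k` is `m`, or some `j
      -- < k` that is below `m` by induction.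
      have hsecond : ∀ k (hk : k < n), 0 < k → k < m →
          draws ω (secondTime m) ⟨k, hk⟩ < draws ω (secondTime m) ⟨m, hm⟩ := by
        intro k
        induction k using Nat.strong_induction_on with
        | _ k ih =>
          intro hk hk0 hkm
          have hi := timeTable_test hm k hk0 hkm 1 (by omega)
          have h := hl (2 * n + 2 * k + 1) (by omega) (by omega)
          rw [Loses, hi] at h
          obtain ⟨j, ⟨hj1, hj2⟩, hlt⟩ := h (by simp only [secondTime]; split_ifs <;> omega)
          have hj : (j : ℕ) = m ∨ (0 < (j : ℕ) ∧ (j : ℕ) ≤ k) := by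
            simp only [secondTime] at hj2
            split_ifs at hj2 <;> omega
          rcases hj with hj | ⟨hj0, hjk⟩
          · have : j = ⟨m, hm⟩ := Fin.ext hj
            exact this ▸ hlt
          · rcases hjk.eq_or_lt with hjk | hjk
            · have : j = ⟨k, hk⟩ := Fin.ext hjk
              exact absurd (this ▸ hlt) (lt_irrefl _)
            · exact hlt.trans (ih j hjk j.isLt hj0 (by omega))
      refine ⟨fun i hi1 hi2 => hsecond i i.isLt hi1 hi2, ?_⟩
      -- `m` must fail its own test too, and after `hsecond` only `0` can beat it.
      have h := hl (2 * n + 2 * m + 1) (by omega) (by omega)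
      rw [Loses, timeTable_last] at h
      obtain ⟨j, ⟨hj1, -⟩, hlt⟩ := h (by simp only [secondTime]; split_ifs <;> omega)
      rcases hj1.eq_or_lt with hj | hj
      · have : j = ⟨m, hm⟩ := Fin.ext hj
        exact absurd (this ▸ hlt) (lt_irrefl _)
      · rcases Nat.eq_zero_or_pos (j : ℕ) with hj0 | hj0
        · have : j = ⟨0, by omega⟩ := Fin.ext hj0
          exact this ▸ hlt
        · exact absurd hlt (hsecond j j.isLt hj0 hj).not_gt

end RoundTwo

/-! ### Probabilities of events on finitely many coins -/

/-- The law of the randomness of one step. -/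
def coinMeasure (n : ℕ) : Measure (Coin n) :=
  (lotteryPMF n).toMeasure.prod (PMF.uniformOfFintype (Fin 100)).toMeasure

instance (n : ℕ) : IsProbabilityMeasure (coinMeasure n) := by
  unfold coinMeasure; infer_instance

instance (n : ℕ) : IsProbabilityMeasure (sourceMeasure n) := by
  unfold sourceMeasure; infer_instance

variable {n : ℕ}

theorem sourceMeasure_real_forall {ι : Type*} [Fintype ι] {e : ι → ℕ} (he : Function.Injective e)
    (A : ι → Set (Coin n)) :
    (sourceMeasure n).real {ω | ∀ i, ω (e i) ∈ A i} = ∏ i, (coinMeasure n).real (A i) := by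
  classical
  have h1 : {ω : Source n | ∀ i, ω (e i) ∈ A i} =
      Set.pi (Finset.univ.image e : Finset ℕ) fun j => {x | ∀ i, e i = j → x ∈ A i} := by
    ext ω
    simp only [Set.mem_ofPred_eq, Set.mem_pi, Finset.coe_image, Finset.coe_univ, Set.image_univ,
      Set.mem_range, forall_exists_index, forall_apply_eq_imp_iff]
    exact ⟨fun h i k hk => he hk ▸ h i, fun h i => h i i rfl⟩
  rw [h1, sourceMeasure, measureReal_def, Measure.infinitePi_pi _ fun _ _ => .of_discrete,
    Finset.prod_image fun _ _ _ _ h => he h, ENNReal.toReal_prod]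
  refine Finset.prod_congr rfl fun i _ => ?_
  have : {x | ∀ k, e k = e i → x ∈ A k} = A i := by
    ext x
    exact ⟨fun h => h i rfl, fun h k hk => he hk ▸ h⟩
  rw [this]
  rfl

theorem measurableSet_forall {ι : Type*} [Fintype ι] (e : ι → ℕ) (A : ι → Set (Coin n)) :
    MeasurableSet {ω : Source n | ∀ i, ω (e i) ∈ A i} := by
  rw [Set.ofPred_forall]
  exact .iInter fun i => (measurable_pi_apply (e i)) (.of_discrete)

theorem coinMeasure_real_fst (S : Set (Lottery n)) :
    (coinMeasure n).real {x | x.1 ∈ S} = (lotteryPMF n).toMeasure.real S := by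
  have : {x : Coin n | x.1 ∈ S} = S ×ˢ Set.univ := by ext; simp
  rw [this, coinMeasure, measureReal_prod_prod]
  simp

theorem coinMeasure_real_snd (r : Fin 100) :
    (coinMeasure n).real {x | x.2 = r} = 1 / 100 := by
  have : {x : Coin n | x.2 = r} = Set.univ ×ˢ {r} := by ext; simp
  rw [this, coinMeasure, measureReal_prod_prod, measureReal_def, measureReal_def,
    PMF.toMeasure_apply_singleton _ _ (.of_discrete)]
  simp

theorem lotteryMeasure_real_singleton (l : Lottery n) :
    (lotteryPMF n).toMeasure.real {l} = (lotteryWeight (maxLottery n) l).toReal := by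
  rw [measureReal_def, PMF.toMeasure_apply_singleton _ _ (.of_discrete)]
  rfl

theorem lotteryMeasure_real_singleton_pos (l : Lottery n) :
    0 < (lotteryPMF n).toMeasure.real {l} := by
  rw [lotteryMeasure_real_singleton, lotteryWeight]
  split_ifs <;> simp [ENNReal.toReal_pow]

/-- The probability that two given ones among `g + 2` draws are the largest and the second largest,
at a given value of the second largest. -/
theorem mul_mul_pow_le {L p G : ℝ} (hL : 0 ≤ L) (hp : 0 ≤ p) (hG : 0 ≤ G) (h : L + p + G = 1)
    {g : ℕ} (hg : 0 < g) : G * (p * L ^ g) ≤ 1 / (2 * (g : ℝ) ^ 2) := by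
  have hg' : (0 : ℝ) < g := by exact_mod_cast hg
  set y := p + G with hy
  have h1 : L ^ g ≤ Real.exp (-(g * y)) := by
    have : L ≤ Real.exp (-y) := by
      have := Real.add_one_le_exp (-y)
      linarith
    calc L ^ g ≤ Real.exp (-y) ^ g := by gcongr
      _ = Real.exp (-(g * y)) := by rw [← Real.exp_nat_mul]; ring_nf
  have h2 : (g * y) ^ 2 / 2 ≤ Real.exp (g * y) := by
    have := Real.quadratic_le_exp_of_nonneg (x := g * y) (by positivity)
    nlinarith [show 0 ≤ g * y by positivity]
  have h3 : (g * y) ^ 2 / 2 * Real.exp (-(g * y)) ≤ 1 := by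
    calc (g * y) ^ 2 / 2 * Real.exp (-(g * y)) ≤ Real.exp (g * y) * Real.exp (-(g * y)) := by gcongr
      _ = 1 := by rw [← Real.exp_add]; simp
  have h4 : G * p ≤ y ^ 2 / 4 := by rw [hy]; nlinarith [sq_nonneg (p - G)]
  rw [le_div_iff₀ (by positivity)]
  calc G * (p * L ^ g) * (2 * (g : ℝ) ^ 2) = G * p * L ^ g * (2 * (g : ℝ) ^ 2) := by ring
    _ ≤ y ^ 2 / 4 * Real.exp (-(g * y)) * (2 * (g : ℝ) ^ 2) := by gcongr
    _ = (g * y) ^ 2 / 2 * Real.exp (-(g * y)) := by ring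
    _ ≤ 1 := h3

theorem lotteryMeasure_second_max (l : Lottery n) {g : ℕ} (hg : 0 < g) :
    (lotteryPMF n).toMeasure.real {x | l < x} * ((lotteryPMF n).toMeasure.real {l} *
      (lotteryPMF n).toMeasure.real {x | x < l} ^ g) ≤ 1 / (2 * (g : ℝ) ^ 2) := by
  refine mul_mul_pow_le measureReal_nonneg measureReal_nonneg measureReal_nonneg ?_ hg
  rw [← measureReal_union (by simp) (.of_discrete), ← measureReal_union ?_ (.of_discrete)]
  · convert probReal_univ (μ := (lotteryPMF n).toMeasure)
    ext x
    simp only [Set.mem_union, Set.mem_ofPred_eq, Set.mem_singleton_iff, Set.mem_univ, iff_true]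
    rcases lt_trichotomy x l with h | h | h <;> simp [h]
  · rw [Set.disjoint_left]
    intro x hx hx'
    simp only [Set.mem_union, Set.mem_ofPred_eq, Set.mem_singleton_iff] at hx hx'
    rcases hx with hx | rfl
    · exact lt_asymm hx hx'
    · exact lt_irrefl _ hx'

/-- The probability that a conditional probability is small, without measurability of the
condition `s`. -/
theorem cond_real_le {Ω : Type*} [MeasurableSpace Ω] (μ : Measure Ω) [IsFiniteMeasure μ]
    {s t u : Set Ω} {x y : ℝ} (hsu : s ⊆ u) (hu : MeasurableSet u) (hx : 0 < x) (hs : x ≤ μ.real s)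
    (ht : μ.real (t ∩ u) ≤ y) : (μ[|s]).real t ≤ y / x := by
  rw [ProbabilityTheory.cond, measureReal_ennreal_smul_apply, ENNReal.toReal_inv, ← measureReal_def]
  have h1 : (μ.restrict s).real t ≤ y := by
    refine le_trans ?_ ht
    rw [← measureReal_restrict_apply' hu]
    -- The restricted measure is monotone in the set, so only `u` has to be measurable.
    exact ENNReal.toReal_mono (measure_ne_top _ _) (Measure.restrict_mono_set _ hsu t)
  calc (μ.real s)⁻¹ * (μ.restrict s).real t ≤ x⁻¹ * y := by
        gcongr
    _ = y / x := by ring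

/-! ### The conditional winning probability of process `0` -/

section WinProb

variable {m : ℕ} (hm : m < n)

/-- The probability of the draws that the run of round one reveals. -/
def revealedProb (n m : ℕ) : ℝ :=
  ∏ i : Fin n, (coinMeasure n).real {x | (x.1 : ℕ) = revealed m i}

theorem revealedProb_pos (hmn : m + 1 < n) (hmb : maxLottery n = n - m + 1) :
    0 < revealedProb n m := by
  refine Finset.prod_pos fun i _ => ?_
  have hi : revealed m i ∈ Finset.Icc 1 (maxLottery n) := by
    have := i.isLt
    rw [Finset.mem_Icc, revealed]
    split_ifs <;> omega
  have : {x : Coin n | (x.1 : ℕ) = revealed m i} =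
      {x : Coin n | x.1 ∈ ({⟨revealed m i, hi⟩} : Set (Lottery n))} := by
    ext x; simp [Subtype.ext_iff]
  rw [this, coinMeasure_real_fst]
  exact lotteryMeasure_real_singleton_pos _

theorem firstTime_injective : Function.Injective (firstTime (n := n) m) := fun i j h => by
  simp only [firstTime] at h
  apply Fin.ext
  split_ifs at h <;> omega

theorem firstTime_lt (i : Fin n) : firstTime m i + 1 < 2 * n := by
  have := i.isLt
  simp only [firstTime]
  split_ifs <;> omega

/-- One favourable event suffices: the revealed draws, both round numbers equal to `0` (`1/100`
each), and a redraw of `2` by `m`. The latter has weight `1/4` because `2` lies below the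
truncation. -/
theorem condEvent_real_ge (hm0 : 2 ≤ m) (hmn : m + 1 < n) (hmb : maxLottery n = n - m + 1) :
    revealedProb n m * (1 / 40000) ≤ (sourceMeasure n).real
      (condEvent (oblivious (timeTable hm)) ⟨0, by omega⟩ 2 (revealingRun hm)) := by
  have hb : 2 < maxLottery n := by unfold maxLottery; omega
  -- The coins of the first draws, then three more: the initial round number, the new one, and the
  -- redraw of `m`.
  let e : Fin n ⊕ Option (Option Unit) → ℕ := Sum.elim (fun i => firstTime m i + 1) fun o =>
    o.elim 0 fun o => o.elim (2 * n) fun _ => 2 * n + 2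
  let A : Fin n ⊕ Option (Option Unit) → Set (Coin n) :=
    Sum.elim (fun i => {x | (x.1 : ℕ) = revealed m i}) fun o => o.elim {x | x.2 = 0}
      fun o => o.elim {x | x.2 = 0} fun _ => {x | x.1 ∈ ({⟨2, by simp; omega⟩} : Set (Lottery n))}
  have he : Function.Injective e := by
    rintro (i | _ | _ | _) (j | _ | _ | _) h <;> simp only [e, Sum.elim_inl, Sum.elim_inr,
      Option.elim_none, Option.elim_some] at h <;> try rfl
    · rw [firstTime_injective (Nat.succ.inj h)]
    · omega
    · have := firstTime_lt (m := m) i; omega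
    · have := firstTime_lt (m := m) i; omega
    · omega
    · omega
    · omega
    · have := firstTime_lt (m := m) j; omega
    · omega
    · omega
    · have := firstTime_lt (m := m) j; omega
    · omega
    · omega
  have hprob := sourceMeasure_real_forall he A
  have h2 : (lotteryPMF n).toMeasure.real {(⟨2, by simp; omega⟩ : Lottery n)} = 1 / 4 := by
    rw [lotteryMeasure_real_singleton, lotteryWeight, if_pos hb]
    simp [ENNReal.toReal_pow]
    norm_num
  rw [Fintype.prod_sum_type, Fintype.prod_option, Fintype.prod_option] at hprob
  simp only [A, Sum.elim_inl, Sum.elim_inr, Option.elim_none, Option.elim_some,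
    coinMeasure_real_fst, coinMeasure_real_snd, h2, Finset.univ_unique, Finset.prod_singleton]
    at hprob
  rw [show revealedProb n m * (1 / 40000) =
    revealedProb n m * (1 / 100 * (1 / 100 * (1 / 4))) by norm_num, revealedProb, ← hprob]
  refine measureReal_mono fun ω hω => ?_
  simp only [e, Set.mem_ofPred_eq, Sum.forall, Option.forall, Sum.elim_inl, Sum.elim_inr,
    Option.elim_none, Option.elim_some, Set.mem_singleton_iff] at hω
  obtain ⟨h1, h3, h4, h5⟩ := hω
  have hd : draws ω (firstTime m) = revealed m := funext h1
  refine ⟨?_, mem_partEvent_of_sameRound hm hm0 hmn hd (h4.trans h3.symm) ?_⟩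
  · rw [runEvent_revealingRun hm hm0 hmn hmb]
    exact hd
  · rw [draws_secondTime]
    exact congrArg Subtype.val (h5 ())

/-- Union bound over the value `l` drawn by `m`, which gives the factor `maxLottery n`. For fixed
`l`, process `0` is above `l` and the `m - 1` processes between are below; these coins are disjoint
from those of round one, so `revealedProb` factors out. -/
theorem winEvent_real_le (hm0 : 2 ≤ m) (hmn : m + 1 < n) :
    (sourceMeasure n).real (winEvent (oblivious (timeTable hm)) ⟨0, by omega⟩ 2 ∩
      {ω | ∀ i : Fin n, ω (firstTime m i + 1) ∈ {x : Coin n | (x.1 : ℕ) = revealed m i}}) ≤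
    revealedProb n m * (maxLottery n / (2 * ((m - 1 : ℕ) : ℝ) ^ 2)) := by
  let e : Fin n ⊕ Option (Option (Fin (m - 1))) → ℕ := Sum.elim (fun i => firstTime m i + 1)
    fun o => o.elim (2 * n + 2 * m + 1) fun o => o.elim (2 * n + 2) fun k => 2 * n + 2 * k + 3
  let A (l : Lottery n) : Fin n ⊕ Option (Option (Fin (m - 1))) → Set (Coin n) :=
    Sum.elim (fun i => {x | (x.1 : ℕ) = revealed m i}) fun o => o.elim {x | x.1 ∈ {y | l < y}}
      fun o => o.elim {x | x.1 ∈ ({l} : Set (Lottery n))} fun _ => {x | x.1 ∈ {y | y < l}}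
  have he : Function.Injective e := by
    rintro (i | _ | _ | k) (j | _ | _ | k') h <;> simp only [e, Sum.elim_inl, Sum.elim_inr,
      Option.elim_none, Option.elim_some] at h <;> try rfl
    · rw [firstTime_injective (Nat.succ.inj h)]
    · have := firstTime_lt (m := m) i; omega
    · have := firstTime_lt (m := m) i; omega
    · have := firstTime_lt (m := m) i; omega
    · have := firstTime_lt (m := m) j; omega
    · omega
    · omega
    · have := firstTime_lt (m := m) j; omega
    · omega
    · omega
    · have := firstTime_lt (m := m) j; omega
    · omega
    · omega
    · rw [Fin.ext (show (k : ℕ) = k' by omega)]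
  have hA : ∀ l, (sourceMeasure n).real {ω | ∀ i, ω (e i) ∈ A l i} ≤
      revealedProb n m * (1 / (2 * ((m - 1 : ℕ) : ℝ) ^ 2)) := by
    intro l
    rw [sourceMeasure_real_forall he, Fintype.prod_sum_type, Fintype.prod_option,
      Fintype.prod_option]
    simp only [A, Sum.elim_inl, Sum.elim_inr, Option.elim_none, Option.elim_some,
      coinMeasure_real_fst, Finset.prod_const, Finset.card_univ, Fintype.card_fin]
    exact mul_le_mul_of_nonneg_left (lotteryMeasure_second_max l (by omega))
      (Finset.prod_nonneg fun _ _ => measureReal_nonneg)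
  calc _ ≤ (sourceMeasure n).real (⋃ l, {ω | ∀ i, ω (e i) ∈ A l i}) := by
        refine measureReal_mono ?_
        rintro ω ⟨hw, hd⟩
        obtain ⟨h1, h2⟩ := draws_of_mem_winEvent hm hm0 hmn (funext hd) hw
        rw [draws_secondTime] at h1 h2
        rw [Set.mem_iUnion]
        refine ⟨(ω (2 * n + 1 + 1)).1, ?_⟩
        simp only [e, A, Set.mem_ofPred_eq, Sum.forall, Option.forall, Sum.elim_inl, Sum.elim_inr,
          Option.elim_none, Option.elim_some, Set.mem_singleton_iff]
        refine ⟨hd, ?_, trivial, fun k => ?_⟩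
        · have h0 : secondTime m (⟨0, by omega⟩ : Fin n) = 2 * n + 2 * m := by
            simp only [secondTime]
            split_ifs <;> omega
          rw [draws, h0] at h2
          exact h2
        · have hk : secondTime m (⟨k + 1, by omega⟩ : Fin n) = 2 * n + 2 * k + 2 := by
            rw [secondTime, if_neg (show (k : ℕ) + 1 ≠ m by omega), if_neg (Nat.succ_ne_zero _)]
            rfl
          have := h1 ⟨k + 1, by omega⟩ k.val.succ_pos (show (k : ℕ) + 1 < m by omega)
          rw [draws, hk] at this
          exact this
    _ ≤ ∑ l : Lottery n, (sourceMeasure n).real {ω | ∀ i, ω (e i) ∈ A l i} :=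
        measureReal_iUnion_fintype_le _
    _ ≤ ∑ _l : Lottery n, revealedProb n m * (1 / (2 * ((m - 1 : ℕ) : ℝ) ^ 2)) :=
        Finset.sum_le_sum fun l _ => hA l
    _ = _ := by
        simp
        ring

end WinProb

/-- Process `0` wins round two of a suitable execution with conditional probability of order
`log n / n ^ 2`. -/
theorem exists_winProb_le {n : ℕ} (hn : maxLottery n + 1 ≤ n) :
    ∃ A : Adversary n, Fair A ∧ ∃ ρ : Run n, IsRoundRun 1 ρ ∧ Compatible A ρ ∧
      sourceMeasure n (condEvent A ⟨0, by omega⟩ 2 ρ) ≠ 0 ∧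
      winProb A ⟨0, by omega⟩ 2 ρ ≤
        20000 * maxLottery n / ((n - maxLottery n : ℕ) : ℝ) ^ 2 := by
  have hb : 4 ≤ maxLottery n := by unfold maxLottery; omega
  -- The choice that leaves the chain of round one no slack.
  obtain ⟨m, hm⟩ : ∃ m, m = n - maxLottery n + 1 := ⟨_, rfl⟩
  have hmn : m < n := by omega
  have hge := condEvent_real_ge hmn (by omega) (by omega) (by omega)
  have hle := winEvent_real_le hmn (by omega) (by omega)
  have hpos := revealedProb_pos (n := n) (m := m) (by omega) (by omega)
  refine ⟨oblivious (timeTable hmn), fair_timeTable hmn, revealingRun hmn,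
    isRoundRun_revealingRun hmn, compatible_revealingRun hmn, fun h0 => ?_, ?_⟩
  · rw [measureReal_def, h0, ENNReal.toReal_zero] at hge
    linarith
  · refine (cond_real_le _ ?_ (measurableSet_forall _ _) (by positivity) hge hle).trans ?_
    · refine Set.inter_subset_left.trans ?_
      rw [show 2 - 1 = 1 from rfl, runEvent_revealingRun hmn (by omega) (by omega) (by omega)]
      exact fun ω hω i => congrFun hω i
    · rw [show n - maxLottery n = m - 1 by omega]
      have : (0 : ℝ) < ((m - 1 : ℕ) : ℝ) := by exact_mod_cast (by omega : 0 < m - 1)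
      apply le_of_eq
      field_simp
      norm_num

/-! ### Asymptotics and conclusion -/

/-- A crude bound of order `√n` on the logarithm is enough, since `√n / n ^ 2` is already `o(1 /
n)`. -/
theorem maxLottery_le (n : ℕ) : maxLottery n ≤ 2 * Nat.sqrt n + 4 := by
  have h1 : n ≤ 2 ^ (2 * Nat.sqrt n) := by
    have h2 := Nat.lt_succ_sqrt n
    have h3 : Nat.sqrt n + 1 ≤ 2 ^ Nat.sqrt n := Nat.lt_two_pow_self
    calc n ≤ (Nat.sqrt n + 1) * (Nat.sqrt n + 1) := h2.le
      _ ≤ 2 ^ Nat.sqrt n * 2 ^ Nat.sqrt n := Nat.mul_le_mul h3 h3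
      _ = 2 ^ (2 * Nat.sqrt n) := by rw [← pow_add, two_mul]
  have := Nat.clog_le_of_le_pow h1
  unfold maxLottery
  omega

/-- The bound on the winning probability is `o(1 / n)`. -/
theorem exists_forall_bound_lt {c : ℝ} (hc : 0 < c) : ∃ N : ℕ, ∀ n, N ≤ n →
    maxLottery n + 1 ≤ n ∧
      20000 * maxLottery n / ((n - maxLottery n : ℕ) : ℝ) ^ 2 < c / n := by
  -- `240000 = 20000 * 3 * 4`, from `maxLottery n ≤ 3 * s` and `n - maxLottery n ≥ n / 2`. Both
  -- follow from `s ≥ 8`, hence the shift by `8` below.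
  obtain ⟨K, hK⟩ := exists_nat_gt (240000 / c)
  refine ⟨(K + 8) ^ 2, fun n hn => ?_⟩
  have hs : K + 8 ≤ Nat.sqrt n := Nat.le_sqrt'.2 hn
  obtain ⟨s, hs'⟩ : ∃ s, s = Nat.sqrt n := ⟨_, rfl⟩
  have hb := maxLottery_le n
  have hsn : s ^ 2 ≤ n := hs' ▸ Nat.sqrt_le' n
  rw [← hs'] at hs hb
  have hb' : maxLottery n ≤ 3 * s := by omega
  have hbn : 2 * maxLottery n ≤ n := by nlinarith
  have hn0 : 0 < n := by nlinarith
  refine ⟨by omega, ?_⟩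
  have hnR : (0 : ℝ) < n := by exact_mod_cast hn0
  have hsR : (K : ℝ) + 8 ≤ s := by exact_mod_cast hs
  have hsnR : (s : ℝ) ^ 2 ≤ n := by exact_mod_cast hsn
  have hbR : (maxLottery n : ℝ) ≤ 3 * s := by exact_mod_cast hb'
  have hbnR : 2 * (maxLottery n : ℝ) ≤ n := by exact_mod_cast hbn
  have hK0 : (0 : ℝ) ≤ K := K.cast_nonneg
  rw [Nat.cast_sub (by omega)]
  have hhalf : (n : ℝ) / 2 ≤ n - maxLottery n := by linarith
  rw [div_lt_iff₀ hc] at hK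
  calc 20000 * (maxLottery n : ℝ) / ((n : ℝ) - maxLottery n) ^ 2
      ≤ 20000 * (3 * (s : ℝ)) / ((n : ℝ) / 2) ^ 2 := by gcongr
    _ = 240000 * (s : ℝ) / n / n := by field_simp; ring
    _ < c / n := by
        gcongr
        rw [div_lt_iff₀ hnR]
        have hs0 : (0 : ℝ) < s := by linarith
        calc 240000 * (s : ℝ) < K * c * s := by gcongr
          _ ≤ s * c * s := by gcongr; linarith
          _ = c * s ^ 2 := by ring
          _ ≤ c * n := by gcongr

theorem not_weakRunKnowingNoLockout : ¬ WeakRunKnowingNoLockout := by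
  rintro ⟨c, hc, h⟩
  obtain ⟨N, hN⟩ := exists_forall_bound_lt hc
  obtain ⟨hb, hlt⟩ := hN N le_rfl
  obtain ⟨A, hA, ρ, h1, h2, h3, h4⟩ := exists_winProb_le hb
  exact absurd (h N A hA 2 (by norm_num) ρ h1 h2 _ h3) (by linarith)

/-- A constant `c < 1` such that `ε + c ^ n ≥ 1` for all `n ≤ N`. -/
theorem exists_one_le_add_pow {ε : ℝ} (h0 : 0 < ε) (h1 : ε < 1) (N : ℕ) :
    ∃ c : ℝ, 0 < c ∧ c < 1 ∧ ∀ n ≤ N, 1 ≤ ε + c ^ n := by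
  have hN : (0 : ℝ) ≤ N := N.cast_nonneg
  have hlt : ε / (N + 1) < 1 := by rw [div_lt_one (by positivity)]; linarith
  have hpos : 0 < ε / (N + 1) := by positivity
  -- Bernoulli's inequality gives `c ^ n ≥ 1 - n * ε / (N + 1) ≥ 1 - ε`.
  refine ⟨1 - ε / (N + 1), by linarith, by linarith, fun n hn => ?_⟩
  have hb := one_add_mul_le_pow (a := -(ε / (N + 1))) (by linarith) n
  have hnN : (n : ℝ) ≤ N := by exact_mod_cast hn
  have : n * (ε / (N + 1)) ≤ ε := by
    rw [mul_div_assoc', div_le_iff₀ (by positivity)]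
    nlinarith
  rw [← sub_eq_add_neg] at hb
  linarith

end Rabin

end

theorem theorem3p2 :
    (∃ c : ℝ, 0 < c ∧ c < 1 ∧ ∀ (n : ℕ) (hn : 0 < n),
      ∃ A : Rabin.Adversary n, Rabin.Fair A ∧
        ∃ k : ℕ, 1 ≤ k ∧ ∃ ρ : Rabin.Run n,
          Rabin.IsRoundRun (k - 1) ρ ∧ Rabin.Compatible A ρ ∧
          Rabin.sourceMeasure n (Rabin.condEvent A ⟨0, hn⟩ k ρ) ≠ 0 ∧
          Rabin.winProb A ⟨0, hn⟩ k ρ ≤ Real.exp (-32) + c ^ n) ∧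
    ¬ Rabin.WeakRunKnowingNoLockout := by
  refine ⟨?_, Rabin.not_weakRunKnowingNoLockout⟩
  obtain ⟨N, hN⟩ := Rabin.exists_forall_bound_lt (Real.exp_pos (-32))
  obtain ⟨c, hc0, hc1, hc⟩ := Rabin.exists_one_le_add_pow (Real.exp_pos (-32))
    (Real.exp_lt_one_iff.2 (by norm_num)) N
  refine ⟨c, hc0, hc1, fun n hn => ?_⟩
  -- For `n ≤ N` the right-hand side is at least one, so any fair adversary with a nonzero condition
  -- will do.
  rcases le_total n N with hnN | hnN
  · refine ⟨Rabin.oblivious (Rabin.soloTable hn), Rabin.fair_oblivious _ 2 fun t ht => ?_, 1, le_rfl,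
      [], ⟨rfl, by simp⟩, Rabin.compatible_oblivious _ _ fun t ht => by simp at ht, ?_, ?_⟩
    · simp [Rabin.soloTable, show ¬ t < 2 by omega]
    · rw [Rabin.condEvent_soloTable]
      simp
    · refine le_trans ?_ (hc n hnN)
      rw [Rabin.winProb]
      exact measureReal_le_one
  · obtain ⟨hb, hlt⟩ := hN n hnN
    obtain ⟨A, hA, ρ, h1, h2, h3, h4⟩ := Rabin.exists_winProb_le hb
    refine ⟨A, hA, 2, by norm_num, ρ, h1, h2, h3, h4.trans (hlt.le.trans ?_)⟩
    have h5 : Real.exp (-32) / n ≤ Real.exp (-32) :=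
      div_le_self (Real.exp_pos _).le (by exact_mod_cast hn)
    have h6 : 0 < c ^ n := pow_pos hc0 n
    linarith
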